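/- Let $k$ be a field, let $P=k[x_1,\dots,x_c]$ be the standard graded polynomial ring in $c$ variables, let $I$ be an ideal of $P$ generated by homogeneous forms of degree at least two, and suppose that $S=P/I$ is Artinian. Write $[\,\cdot\,]_i$ for homogeneous components of degree $i$, $S_+=\sum_{i\ge1}[S]_i$, $\operatorname{socle}S=0:_SS_+$, and $r=\dim_k\operatorname{socle}S$ (the type of $S$). The algebra $S$ is Gorenstein if $r=1$; it is level of socle degree $e$ if its socle is concentrated in degree $e$; and it is a compressed level algebra if it is level of some socle degree $e$ and $$\dim_k[S]_i=\min\{\dim_k[P]_i,\ r\cdot\dim_k[P]_{e-i}\}\qquad\text{for } 0\le i\le e.$$ Suppose that $S$ is Gorenstein, and that its minimal homogeneous resolution $$0\to F_c\xrightarrow{f_c}F_{c-1}\to\cdots\xrightarrow{f_2}F_1\xrightarrow{f_1}F_0$$ by free $P$-modules is linear in the sense for Gorenstein algebras: for some integer $n\ge2$ the entries of (the matrices of) $f_1$ and $f_c$ are homogeneous forms of degree $n$, and the entries of $f_i$ are linear forms for $2\le i\le c-1$. Then $S$ is a compressed level algebra. In particular, if the codimension $c$, the socle degree $e$ and the type $r$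 of $S$ satisfy $$r=1,\qquad 2\le e,\qquad e\ne3,\qquad 3\le c,$$ then $S$ has no homogeneous exact zero divisors; that is, there is no homogeneous $a\in S$ for which there exists $b\in S$ with $a\neq0$, $b\ne0$, $(0:_Sa)=(b)$ and $(0:_Sb)=(a)$. -/

import Mathlib

namespace GradedArtin

open MvPolynomial

variable {k : Type*} [Field k] {c : ℕ}

/-- The homogeneous component `[P]_d` of `P = k[x_1, …, x_c]`, for `d : ℤ`
(it is zero in negative degrees). -/
noncomputable def polyPiece (k : Type*) [Field k] (c : ℕ) (d : ℤ) : Submodule k (MvPolynomial (Fin c) k) :=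
  if 0 ≤ d then homogeneousSubmodule (Fin c) k d.toNat else ⊥

/-- `I` is generated by homogeneous forms of degree at least two. -/
def GeneratedInDegreeGeTwo (I : Ideal (MvPolynomial (Fin c) k)) : Prop :=
  ∃ G : Set (MvPolynomial (Fin c) k),
    (∀ g ∈ G, ∃ d : ℕ, 2 ≤ d ∧ g.IsHomogeneous d) ∧ I = Ideal.span G

/-- The homogeneous component `[S]_d` of `S = P/I`: the image of `[P]_d`. -/
noncomputable def quotPiece (I : Ideal (MvPolynomial (Fin c) k)) (d : ℤ) :
    Submodule k (MvPolynomial (Fin c) k ⧸ I) :=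
  (polyPiece k c d).map (Ideal.Quotient.mkₐ k I).toLinearMap

/-- The Hilbert function of `S = P/I`. -/
noncomputable def hilbert (I : Ideal (MvPolynomial (Fin c) k)) (d : ℤ) : ℕ :=
  Module.finrank k (quotPiece I d)

/-- The maximal homogeneous ideal `P_+ = (x_1, …, x_c)` of `P`. -/
noncomputable def polyPlus (k : Type*) [Field k] (c : ℕ) : Ideal (MvPolynomial (Fin c) k) :=
  Ideal.span (Set.range X)

/-- The ideal `S_+` of `S = P/I`. -/
noncomputable def quotPlus (I : Ideal (MvPolynomial (Fin c) k)) : Ideal (MvPolynomial (Fin c) k ⧸ I) :=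
  (polyPlus k c).map (Ideal.Quotient.mk I)

/-- The socle `0 :_S S_+` of `S = P/I`, as a vector space over `k`. -/
noncomputable def socle (I : Ideal (MvPolynomial (Fin c) k)) : Submodule k (MvPolynomial (Fin c) k ⧸ I) :=
  ((⊥ : Ideal (MvPolynomial (Fin c) k ⧸ I)).colon
    (quotPlus I : Set (MvPolynomial (Fin c) k ⧸ I))).restrictScalars k

/-- The type of `S = P/I`. -/
noncomputable def algType (I : Ideal (MvPolynomial (Fin c) k)) : ℕ :=
  Module.finrank k (socle I)

/-- `S = P/I` is Gorenstein: it has type one. -/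
def IsGorenstein (I : Ideal (MvPolynomial (Fin c) k)) : Prop :=
  algType I = 1

/-- `S = P/I` is level with socle degree `e`: its (nonzero) socle is concentrated in degree `e`. -/
def IsLevel (I : Ideal (MvPolynomial (Fin c) k)) (e : ℤ) : Prop :=
  socle I ≠ ⊥ ∧ socle I ≤ quotPiece I e

/-- `S = P/I` is a compressed level algebra. -/
def IsCompressedLevel (I : Ideal (MvPolynomial (Fin c) k)) : Prop :=
  ∃ e : ℤ, IsLevel I e ∧ ∀ i : ℤ, 0 ≤ i → i ≤ e →
    hilbert I i = min (Module.finrank k (polyPiece k c i))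
      (algType I * Module.finrank k (polyPiece k c (e - i)))

/-- `(a, b)` is an exact pair of zero divisors: `(0 : a) = (b)` and `(0 : b) = (a)`. The trivial
pairs formed by zero and a unit are excluded. -/
def IsExactPair {R : Type*} [CommRing R] (a b : R) : Prop :=
  a ≠ 0 ∧ b ≠ 0 ∧ (⊥ : Ideal R).colon {a} = Ideal.span {b} ∧
    (⊥ : Ideal R).colon {b} = Ideal.span {a}

/-- `a` is a homogeneous exact zero divisor in `S = P/I`. -/
def IsHomogeneousExactZeroDivisor (I : Ideal (MvPolynomial (Fin c) k))
    (a : MvPolynomial (Fin c) k ⧸ I) : Prop :=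
  (∃ d : ℤ, a ∈ quotPiece I d) ∧ ∃ b, IsExactPair a b

/-- The component of degree `d` of the graded free module `⨁ⱼ P(-aⱼ)`, whose basis elements have
degrees `aⱼ`. -/
def freePiece {r : ℕ} (a : Fin r → ℤ) (d : ℤ) : Set (Fin r → MvPolynomial (Fin c) k) :=
  {x | ∀ j, x j ∈ polyPiece k c (d - a j)}

/-- A minimal homogeneous resolution `0 → F_c → ⋯ → F_1 → F_0` of `S = P/I` by finitely generated
graded free `P`-modules `F_i = ⨁ⱼ P(-aᵢⱼ)`. Here `F.f i` is the differential
`f_{i+1} : F_{i+1} → F_i`. -/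
structure MinimalResolution (I : Ideal (MvPolynomial (Fin c) k)) where
  /-- the rank of `F_i` -/
  rank : ℕ → ℕ
  /-- the degrees `aᵢⱼ` of the basis elements of `F_i` -/
  deg : (i : ℕ) → Fin (rank i) → ℤ
  /-- the differential `f_{i+1} : F_{i+1} → F_i` -/
  f : (i : ℕ) → (Fin (rank (i + 1)) → MvPolynomial (Fin c) k) →ₗ[MvPolynomial (Fin c) k]
    (Fin (rank i) → MvPolynomial (Fin c) k)
  /-- the augmentation `F_0 → S` -/
  aug : (Fin (rank 0) → MvPolynomial (Fin c) k) →ₗ[MvPolynomial (Fin c) k]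
    (MvPolynomial (Fin c) k ⧸ I)
  rank_eq_zero : ∀ i, c < i → rank i = 0
  f_homogeneous : ∀ i d x, x ∈ freePiece (deg (i + 1)) d → f i x ∈ freePiece (deg i) d
  aug_homogeneous : ∀ d x, x ∈ freePiece (deg 0) d → aug x ∈ quotPiece I d
  aug_surjective : Function.Surjective aug
  exact_zero : Function.Exact (f 0) aug
  exact_succ : ∀ i, Function.Exact (f (i + 1)) (f i)
  minimal : ∀ i, LinearMap.range (f i) ≤
    polyPlus k c • (⊤ : Submodule (MvPolynomial (Fin c) k)
      (Fin (rank i) → MvPolynomial (Fin c) k))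

/-- The entries of the matrix of `f_{i+1}` are homogeneous forms of degree `n`
(the zero form is allowed). -/
def MinimalResolution.EntriesOfDegree {I : Ideal (MvPolynomial (Fin c) k)}
    (F : MinimalResolution I) (i n : ℕ) : Prop :=
  ∀ u v, (F.f i (Pi.single v 1) u).IsHomogeneous n

/-- The resolution is linear. If `S` is not Gorenstein: the entries of `f_1` have the same degree
`n ≥ 2`, and the entries of `f_j` are linear for `2 ≤ j`. If `S` is Gorenstein: the entries of `f_1`
and `f_c` have the same degree `n ≥ 2`, and the entries of `f_j` are linear for
`2 ≤ j ≤ c - 1`. (Recall that `F.f i` is `f_{i+1}`.) -/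
def MinimalResolution.IsLinear {I : Ideal (MvPolynomial (Fin c) k)}
    (F : MinimalResolution I) : Prop :=
  ∃ n : ℕ, 2 ≤ n ∧ F.EntriesOfDegree 0 n ∧
    (¬ IsGorenstein I → ∀ i, 1 ≤ i → F.EntriesOfDegree i 1) ∧
    (IsGorenstein I → (∀ i, i + 1 = c → F.EntriesOfDegree i n) ∧
      ∀ i, 1 ≤ i → i + 1 < c → F.EntriesOfDegree i 1)

/-- The numerical condition on codimension `c`, socle degree `e` and type `r`. -/
def ConditionA (c : ℕ) (e : ℤ) (r : ℕ) : Prop :=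
  r = 1 ∧ 2 ≤ e ∧ e ≠ 3 ∧ 3 ≤ c

end GradedArtin

/-! Minimality and the degrees of the entries force the shifts of the resolution: `F_0 = P`, the
generators of `F_i` have degree `n + i - 1` for `1 ≤ i ≤ c - 1`, and those of `F_c` have degree `2n
+ c - 2`. Hence `S` agrees with `P` in degrees below `n`, and the Hilbert series times `(1 - X) ^ c`
is a polynomial of degree at most `n + c - 2` plus a multiple of `X ^ (2n + c - 2)`. Comparing
degrees gives socle degree `e = 2m` with `m = n - 1` (`top_degree_add_two`). A one-dimensional socle
makes multiplication into degree `2m` a perfect pairing, so the Hilbert function is symmetric about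
`m`; as it is that of `P` up to `m`, the algebra is compressed. This reading needs `c ≥ 2`; smaller
`c` is done by hand.

For zero divisors, let `a`, `b` be an exact pair. Since `S` is local, `b` may be taken homogeneous.
Let `α`, `β ≥ 1` be the degrees and `D` the Hilbert function of a hypersurface of degree `α` in `P`.
In degree `m` the kernel of `b` consists of multiples of `a`, so `b [S]_m` has dimension at least `D
m`. It lies in the annihilator of `a` in degree `m + β`, which by duality has dimension at most `D
(m - β)` when `β ≤ m`, and is zero otherwise. But `D` is strictly increasing when `c ≥ 3`, a
contradiction (`not_forall_dvd_of_mul_eq_zero`). -/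

namespace GradedArtin

open DirectSum MvPolynomial

/-! ### Poincaré duality in a graded algebra. -/

section GradedDuality

variable {k A : Type*} [Field k] [CommRing A] [Algebra k A] (𝒜 : ℕ → Submodule k A)

/-- Multiplication into the top degree `e` is nondegenerate. -/
def Nondegenerate (e : ℕ) : Prop :=
  ∀ i, ∀ x ∈ 𝒜 i, x ≠ 0 → ∃ j, i + j = e ∧ ∃ y ∈ 𝒜 j, x * y ≠ 0

/-- Multiply `x` into the largest possible degree without killing it: the product is annihilated by
all positive degrees, so it is a socle element and sits in degree `e`. -/
theorem nondegenerate_of_socle_le [SetLike.GradedMonoid 𝒜] {e : ℕ}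
    (htop : ∀ d, e < d → 𝒜 d = ⊥)
    (hsocle : ∀ x, (∀ j, 1 ≤ j → ∀ y ∈ 𝒜 j, x * y = 0) → x ∈ 𝒜 e)
    (hdisj : ∀ i j x, x ∈ 𝒜 i → x ∈ 𝒜 j → x ≠ 0 → i = j) :
    Nondegenerate 𝒜 e := by
  classical
  intro i x hx hx0
  let p : ℕ → Prop := fun j => ∃ y ∈ 𝒜 j, x * y ≠ 0
  have hp0 : p 0 := ⟨1, SetLike.GradedOne.one_mem, by simpa using hx0⟩
  have hbound : ∀ j, p j → j ≤ e := by
    rintro j ⟨y, hy, hxy⟩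
    by_contra h
    rw [htop j (by omega), Submodule.mem_bot] at hy
    simp [hy] at hxy
  obtain ⟨y, hy, hxy⟩ : p (Nat.findGreatest p e) := Nat.findGreatest_spec (Nat.zero_le e) hp0
  have hmem : x * y ∈ 𝒜 (i + Nat.findGreatest p e) := SetLike.GradedMul.mul_mem hx hy
  refine ⟨_, hdisj _ _ _ hmem (hsocle _ fun j hj z hz => ?_) hxy, y, hy, hxy⟩
  by_contra h
  have hpj : p (Nat.findGreatest p e + j) :=
    ⟨y * z, SetLike.GradedMul.mul_mem hy hz, by rwa [← mul_assoc]⟩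
  have := Nat.le_findGreatest (hbound _ hpj) hpj
  omega

/-- The pairing `𝒜 j → (𝒜 i)*` induced by a linear form on `A`. -/
noncomputable def pairing (φ : A →ₗ[k] k) (i j : ℕ) : 𝒜 j →ₗ[k] Module.Dual k (𝒜 i) :=
  ((LinearMap.mul k A).compr₂ φ).domRestrict₁₂ (𝒜 j) (𝒜 i)

theorem pairing_apply (φ : A →ₗ[k] k) (i j : ℕ) (y : 𝒜 j) (x : 𝒜 i) :
    pairing 𝒜 φ i j y x = φ (y * x) := rfl

variable {𝒜}

/-- The form is arbitrary outside degree `e`, which is harmless because the pairing is only used in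
complementary degrees. -/
theorem exists_form_ne_zero {e : ℕ} (h1 : Module.finrank k (𝒜 e) = 1) :
    ∃ φ : A →ₗ[k] k, ∀ x ∈ 𝒜 e, x ≠ 0 → φ x ≠ 0 := by
  have : FiniteDimensional k (𝒜 e) := FiniteDimensional.of_finrank_pos (by omega)
  obtain ⟨v, hv, hspan⟩ := finrank_eq_one_iff'.1 h1
  obtain ⟨φ, hφ⟩ : ∃ φ : A →ₗ[k] k, φ v = 1 := by
    have := LinearMap.exists_extend (p := 𝒜 e)
      ((LinearEquiv.ofFinrankEq (𝒜 e) k (by simp [h1])).toLinearMap)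
    obtain ⟨g, hg⟩ := this
    have hgv : g v ≠ 0 := by
      have := LinearMap.congr_fun hg v
      simp only [LinearMap.comp_apply, Submodule.subtype_apply, LinearEquiv.coe_coe] at this
      rw [this]
      simpa using hv
    exact ⟨(g v)⁻¹ • g, by simp [hgv]⟩
  refine ⟨φ, fun x hx hx0 => ?_⟩
  obtain ⟨r, hr⟩ := hspan ⟨x, hx⟩
  have hr' : x = r • (v : A) := by simpa using (congrArg Subtype.val hr).symm
  rw [hr', map_smul, hφ, smul_eq_mul, mul_one]
  rintro rfl
  simp [hr'] at hx0

variable [SetLike.GradedMonoid 𝒜]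

theorem pairing_injective {e i j : ℕ} (hij : i + j = e) (hnd : Nondegenerate 𝒜 e)
    {φ : A →ₗ[k] k} (hφ : ∀ x ∈ 𝒜 e, x ≠ 0 → φ x ≠ 0) :
    Function.Injective (pairing 𝒜 φ i j) := by
  rw [injective_iff_map_eq_zero]
  intro y hy
  by_contra h0
  obtain ⟨l, hl, x, hx, hyx⟩ := hnd j y y.2 (by simpa using h0)
  obtain rfl : l = i := by omega
  refine hφ (y * x) (hl ▸ SetLike.GradedMul.mul_mem y.2 hx) hyx ?_
  simpa [pairing_apply] using LinearMap.congr_fun hy ⟨x, hx⟩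

/-- Multiplication by a homogeneous element between graded pieces. -/
def mulPiece {α : ℕ} {a : A} (ha : a ∈ 𝒜 α) {i j : ℕ} (h : α + i = j) : 𝒜 i →ₗ[k] 𝒜 j :=
  (LinearMap.mulLeft k a).restrict fun _ hx => h ▸ SetLike.GradedMul.mul_mem ha hx

@[simp]
theorem coe_mulPiece {α : ℕ} {a : A} (ha : a ∈ 𝒜 α) {i j : ℕ} (h : α + i = j) (x : 𝒜 i) :
    (mulPiece ha h x : A) = a * x := rfl

variable [∀ i, FiniteDimensional k (𝒜 i)]

theorem finrank_eq_of_nondegenerate {e i j : ℕ} (hij : i + j = e) (hnd : Nondegenerate 𝒜 e)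
    (h1 : Module.finrank k (𝒜 e) = 1) :
    Module.finrank k (𝒜 i) = Module.finrank k (𝒜 j) := by
  obtain ⟨φ, hφ⟩ := exists_form_ne_zero h1
  apply le_antisymm
  · simpa [Subspace.dual_finrank_eq] using LinearMap.finrank_le_finrank_of_injective
      (pairing_injective (i := j) (j := i) (by omega) hnd hφ)
  · simpa [Subspace.dual_finrank_eq] using LinearMap.finrank_le_finrank_of_injective
      (pairing_injective hij hnd hφ)

theorem pairing_surjective {e i j : ℕ} (hij : i + j = e) (hnd : Nondegenerate 𝒜 e)
    (h1 : Module.finrank k (𝒜 e) = 1)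
    {φ : A →ₗ[k] k} (hφ : ∀ x ∈ 𝒜 e, x ≠ 0 → φ x ≠ 0) :
    Function.Surjective (pairing 𝒜 φ i j) :=
  (LinearMap.injective_iff_surjective_of_finrank_eq_finrank (by
    rw [Subspace.dual_finrank_eq, finrank_eq_of_nondegenerate hij hnd h1])).1
    (pairing_injective hij hnd hφ)

/-- The annihilator of `a` in degree `j` is small when `a` acts injectively in the dual degrees. -/
theorem finrank_ker_mulPiece_add_le {e α i j l : ℕ} {a : A} (ha : a ∈ 𝒜 α)
    (hnd : Nondegenerate 𝒜 e) (h1 : Module.finrank k (𝒜 e) = 1)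
    (hl : α + l = i) (hij : i + j = e) (hinj : Function.Injective (mulPiece ha hl)) :
    Module.finrank k (LinearMap.ker (mulPiece ha (rfl : α + j = α + j))) +
      Module.finrank k (𝒜 l) ≤ Module.finrank k (𝒜 j) := by
  obtain ⟨φ, hφ⟩ := exists_form_ne_zero h1
  -- `T y` is the functional `x ↦ φ (y * (a * x))`. It vanishes when `a * y = 0`, and `T` is onto
  -- because the transpose of an injection is surjective.
  let T : 𝒜 j →ₗ[k] Module.Dual k (𝒜 l) := (mulPiece ha hl).dualMap ∘ₗ pairing 𝒜 φ i j
  have hT : Function.Surjective T :=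
    (LinearMap.dualMap_surjective_of_injective hinj).comp (pairing_surjective hij hnd h1 hφ)
  have hker : LinearMap.ker (mulPiece ha (rfl : α + j = α + j)) ≤ LinearMap.ker T := by
    intro y hy
    have hy' : a * (y : A) = 0 := by simpa using congrArg Subtype.val (LinearMap.mem_ker.1 hy)
    rw [LinearMap.mem_ker]
    ext x
    simp only [T, LinearMap.comp_apply, LinearMap.dualMap_apply, pairing_apply, coe_mulPiece,
      LinearMap.zero_apply]
    rw [← mul_assoc, mul_comm (y : A), hy', zero_mul, map_zero]
  have := T.finrank_range_add_finrank_ker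
  rw [LinearMap.range_eq_top.2 hT, finrank_top, Subspace.dual_finrank_eq] at this
  have := Submodule.finrank_mono hker
  omega

end GradedDuality

/-! ### Exact pairs of zero divisors and dimension counts. -/

section ExactPairs

variable {k A : Type*} [Field k] [CommRing A] [Algebra k A] {𝒜 : ℕ → Submodule k A}
  [GradedAlgebra 𝒜]

theorem eq_of_mem_of_mem {i j : ℕ} {x : A} (hi : x ∈ 𝒜 i) (hj : x ∈ 𝒜 j) (h0 : x ≠ 0) : i = j :=
  DirectSum.degree_eq_of_mem_mem 𝒜 hi hj h0

/-- A multiple of `a` in degree `α + j` is the multiple by an element of degree `j`. -/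
theorem exists_mem_mul_eq {α j : ℕ} {a x : A} (ha : a ∈ 𝒜 α) (hx : x ∈ 𝒜 (α + j))
    (hd : a ∣ x) : ∃ y ∈ 𝒜 j, a * y = x := by
  obtain ⟨y, rfl⟩ := hd
  refine ⟨decompose 𝒜 y j, SetLike.coe_mem _, ?_⟩
  rw [← coe_decompose_mul_add_of_left_mem 𝒜 ha, decompose_of_mem_same 𝒜 hx]

theorem eq_zero_of_dvd_of_lt {α j : ℕ} {a x : A} (ha : a ∈ 𝒜 α) (hx : x ∈ 𝒜 j) (hj : j < α)
    (hd : a ∣ x) : x = 0 := by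
  obtain ⟨y, rfl⟩ := hd
  rw [← decompose_of_mem_same 𝒜 hx]
  exact coe_decompose_mul_of_left_mem_of_not_le 𝒜 ha (by omega)

theorem choose_lt_choose_left {t x y : ℕ} (ht : t + 1 ≤ x) (hxy : x < y) :
    x.choose (t + 1) < y.choose (t + 1) := by
  obtain ⟨y, rfl⟩ : ∃ z, y = z + 1 := ⟨y - 1, by omega⟩
  have h := Nat.choose_le_choose (t + 1) (show x ≤ y by omega)
  have := Nat.choose_pos (show t ≤ y by omega)
  rw [Nat.choose_succ_succ' y t]
  omega

/-- The Hilbert function of a hypersurface of dimension at least two is strictly increasing. -/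
theorem choose_sub_lt_choose_sub {t α β m : ℕ} (hα : 1 ≤ α) (hβ : 1 ≤ β) (hβm : β ≤ m) :
    (((m - β) + (t + 2)).choose (t + 2) : ℤ) -
        (if α ≤ m - β then ((m - β - α + (t + 2)).choose (t + 2) : ℤ) else 0) <
      ((m + (t + 2)).choose (t + 2) : ℤ) -
        (if α ≤ m then ((m - α + (t + 2)).choose (t + 2) : ℤ) else 0) := by
  let D : ℕ → ℤ := fun i => ((i + (t + 2)).choose (t + 2) : ℤ) -
        (if α ≤ i then ((i - α + (t + 2)).choose (t + 2) : ℤ) else 0)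
  have hD : StrictMono D := by
    refine strictMono_nat_of_lt_succ fun i => ?_
    have key : ∀ j, ((j + 1 + (t + 2)).choose (t + 2) : ℤ) =
        ((j + (t + 2)).choose (t + 2) : ℤ) + ((j + (t + 2)).choose (t + 1) : ℤ) := by
      intro j
      have : j + 1 + (t + 2) = (j + (t + 2)) + 1 := by ring
      rw [this, Nat.choose_succ_succ' _ (t + 1)]
      push_cast
      ring
    have hpos : 0 < (i + (t + 2)).choose (t + 1) := Nat.choose_pos (by omega)
    simp only [D]
    -- By Pascal's rule the increment of `D` is a difference of binomials. At `i + 1 = α` the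
    -- subtracted term first appears, with value `1`.
    rcases lt_trichotomy α (i + 1) with h | h | h
    · rw [if_pos (by omega), if_pos (by omega), show i + 1 - α = (i - α) + 1 by omega, key, key]
      have : (i - α + (t + 2)).choose (t + 1) < (i + (t + 2)).choose (t + 1) :=
        choose_lt_choose_left (by omega) (by omega)
      omega
    · rw [if_neg (by omega), if_pos (by omega), show i + 1 - α = 0 by omega, key]
      have := choose_lt_choose_left (t := t) le_rfl (show t + 1 < i + (t + 2) by omega)
      simp only [zero_add, Nat.choose_self] at this ⊢
      omega
    · rw [if_neg (by omega), if_neg (by omega), key]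
      omega
  exact hD (by omega)

section Local

variable {e : ℕ} (h0 : ∀ x ∈ 𝒜 0, ∃ r : k, algebraMap k A r = x) (htop : ∀ d, e < d → 𝒜 d = ⊥)
include h0 htop

/-- Homogeneous elements of positive degree are nilpotent: their powers of exponent `e + 1` lie
above the top degree. -/
theorem exists_sub_mem_nilradical (x : A) :
    ∃ r : k, x - algebraMap k A r ∈ nilradical A := by
  classical
  obtain ⟨r, hr⟩ := h0 _ (SetLike.coe_mem (decompose 𝒜 x 0))
  refine ⟨r, ?_⟩
  have hnil : ∀ i, i ≠ 0 → (decompose 𝒜 x i : A) ∈ nilradical A := fun i hi => by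
    refine mem_nilradical.2 ⟨e + 1, ?_⟩
    have := SetLike.pow_mem_graded (e + 1) (SetLike.coe_mem (decompose 𝒜 x i))
    rw [htop _ (by simp only [smul_eq_mul]; nlinarith [Nat.pos_of_ne_zero hi])] at this
    simpa using this
  have hx : x - algebraMap k A r =
      ∑ i ∈ (decompose 𝒜 x).support.erase 0, (decompose 𝒜 x i : A) := by
    have hsum := DirectSum.sum_support_decompose 𝒜 x
    by_cases hmem : 0 ∈ (decompose 𝒜 x).support
    · rw [← Finset.add_sum_erase _ _ hmem, ← hr] at hsum
      rw [sub_eq_iff_eq_add', hsum]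
    · have hz : (decompose 𝒜 x 0 : A) = 0 := by simpa using hmem
      rw [Finset.erase_eq_of_notMem hmem, hsum, hr, hz, sub_zero]
  rw [hx]
  exact Ideal.sum_mem _ fun i hi => hnil i (Finset.ne_of_mem_erase hi)

theorem isLocalRing_of_graded [Nontrivial A] : IsLocalRing A := by
  refine .of_isUnit_or_isUnit_one_sub_self fun x => ?_
  obtain ⟨r, hr⟩ := exists_sub_mem_nilradical h0 htop x
  rw [mem_nilradical] at hr
  by_cases hr0 : r = 0
  · right
    rw [hr0, map_zero, sub_zero] at hr
    exact hr.isUnit_one_sub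
  · left
    have := hr.isUnit_add_left_of_commute ((IsUnit.mk0 r hr0).map (algebraMap k A))
      (Commute.all _ _)
    simpa using this

/-- A principal annihilator of a homogeneous element has a homogeneous generator. -/
theorem exists_homogeneous_associated {α : ℕ} {a b : A} (ha : a ∈ 𝒜 α) (hb : b ≠ 0)
    (hab : ∀ x, a * x = 0 ↔ b ∣ x) : ∃ β, ∃ b' ∈ 𝒜 β, b ∣ b' ∧ b' ∣ b := by
  classical
  have : Nontrivial A := ⟨b, 0, hb⟩
  have := isLocalRing_of_graded h0 htop
  have hdvd : ∀ i, b ∣ decompose 𝒜 b i := fun i => by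
    rw [← hab, ← coe_decompose_mul_add_of_left_mem 𝒜 ha, (hab b).2 dvd_rfl]
    simp
  choose f hf using hdvd
  -- Each component of `b` is `b * f i`, so `b * (1 - ∑ f i) = 0`. If no `f i` were a unit, the
  -- second factor would be one by locality, forcing `b = 0`.
  obtain ⟨i, hi⟩ : ∃ i, IsUnit (f i) := by
    by_contra! h
    have hmem : ∑ i ∈ (decompose 𝒜 b).support, f i ∈ IsLocalRing.maximalIdeal A :=
      Ideal.sum_mem _ fun i _ => (IsLocalRing.mem_maximalIdeal _).2 (h i)
    have hu : IsUnit (1 - ∑ i ∈ (decompose 𝒜 b).support, f i) := by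
      by_contra hn
      have := Ideal.add_mem _ ((IsLocalRing.mem_maximalIdeal _).2 hn) hmem
      rw [sub_add_cancel] at this
      exact (IsLocalRing.mem_maximalIdeal _).1 this isUnit_one
    apply hb
    rw [← hu.mul_left_eq_zero, mul_sub, mul_one, Finset.mul_sum, sub_eq_zero]
    simp_rw [← hf]
    exact (DirectSum.sum_support_decompose 𝒜 b).symm
  refine ⟨i, _, SetLike.coe_mem (decompose 𝒜 b i), ⟨f i, hf i⟩, ?_⟩
  obtain ⟨u, hu⟩ := hi
  exact ⟨↑u⁻¹, by rw [hf i, ← hu, mul_assoc, Units.mul_inv, mul_one]⟩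

end Local

/-- Two homogeneous elements of positive degree cannot annihilate each other exactly in a graded
Gorenstein algebra of socle degree `2 * m` which agrees with a polynomial ring in at least three
variables up to degree `m`. -/
theorem not_forall_dvd_of_mul_eq_zero [∀ i, FiniteDimensional k (𝒜 i)] {m t α β : ℕ} {a b : A}
    (hnd : Nondegenerate 𝒜 (2 * m)) (h1 : Module.finrank k (𝒜 (2 * m)) = 1)
    (htop : ∀ d, 2 * m < d → 𝒜 d = ⊥)
    (hdim : ∀ i ≤ m, Module.finrank k (𝒜 i) = (i + (t + 2)).choose (t + 2))
    (hdom : ∀ i j, i + j ≤ m → ∀ x ∈ 𝒜 i, ∀ y ∈ 𝒜 j, x * y = 0 → x = 0 ∨ y = 0)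
    (hα : 1 ≤ α) (hβ : 1 ≤ β) (ha : a ∈ 𝒜 α) (ha0 : a ≠ 0) (hb : b ∈ 𝒜 β) (hab : a * b = 0) :
    ¬ ∀ x, b * x = 0 → a ∣ x := by
  intro hann
  have hinj : ∀ l i (h : α + l = i), i ≤ m → Function.Injective (mulPiece ha h) := by
    intro l i h hi
    rw [injective_iff_map_eq_zero]
    intro x hx
    have hx' : a * (x : A) = 0 := by simpa using congrArg Subtype.val hx
    simpa [ha0] using hdom α l (by omega) a ha x x.2 hx'
  -- the kernel of `b` in degree `m` consists of multiples of `a`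
  have hkerb : (Module.finrank k (LinearMap.ker (mulPiece hb (rfl : β + m = β + m))) : ℤ) ≤
      if α ≤ m then ((m - α + (t + 2)).choose (t + 2) : ℤ) else 0 := by
    split_ifs with h
    · have hle : LinearMap.ker (mulPiece hb (rfl : β + m = β + m)) ≤
          LinearMap.range (mulPiece ha (show α + (m - α) = m by omega)) := by
        intro x hx
        have hx' : b * (x : A) = 0 := by
          simpa using congrArg Subtype.val (LinearMap.mem_ker.1 hx)
        obtain ⟨y, hy, hyx⟩ := exists_mem_mul_eq (j := m - α) ha
          (show (x : A) ∈ 𝒜 (α + (m - α)) by rw [show α + (m - α) = m by omega]; exact x.2)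
          (hann _ hx')
        exact ⟨⟨y, hy⟩, Subtype.ext hyx⟩
      have h2 := Submodule.finrank_mono hle
      have h3 := LinearMap.finrank_range_le (mulPiece ha (show α + (m - α) = m by omega))
      rw [hdim _ (by omega)] at h3
      exact_mod_cast h2.trans h3
    · have : LinearMap.ker (mulPiece hb (rfl : β + m = β + m)) = ⊥ := by
        rw [eq_bot_iff]
        intro x hx
        have hx' : b * (x : A) = 0 := by
          simpa using congrArg Subtype.val (LinearMap.mem_ker.1 hx)
        exact Subtype.ext (eq_zero_of_dvd_of_lt ha x.2 (by omega) (hann _ hx'))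
      simp [this]
  -- the annihilator of `a` in degree `β + m`
  have hrank := (mulPiece hb (rfl : β + m = β + m)).finrank_range_add_finrank_ker
  rw [hdim m le_rfl] at hrank
  -- As `a * b = 0`, the image of `b` bounds the annihilator of `a` in degree `β + m` from below;
  -- duality with degree `m - β` bounds it from above.
  have hle : LinearMap.range (mulPiece hb (rfl : β + m = β + m)) ≤
      LinearMap.ker (mulPiece ha (rfl : α + (β + m) = α + (β + m))) := by
    rintro _ ⟨x, rfl⟩
    rw [LinearMap.mem_ker]
    ext
    simp [← mul_assoc, hab]
  have hle' := Submodule.finrank_mono hle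
  by_cases hβm : β ≤ m
  · have hlt := choose_sub_lt_choose_sub (t := t) hα hβ hβm
    have hsym := finrank_eq_of_nondegenerate (show (m - β) + (β + m) = 2 * m by omega) hnd h1
    rw [hdim _ (by omega)] at hsym
    by_cases hαm : α ≤ m - β
    · rw [if_pos hαm] at hlt
      have := finrank_ker_mulPiece_add_le ha hnd h1 (show α + (m - β - α) = m - β by omega)
        (show (m - β) + (β + m) = 2 * m by omega) (hinj _ _ _ (by omega))
      rw [hdim (m - β - α) (by omega)] at this
      omega
    · rw [if_neg hαm] at hlt
      have := Submodule.finrank_le (LinearMap.ker (mulPiece ha (rfl : α + (β + m) = α + (β + m))))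
      omega
  -- Here `b` maps degree `m` beyond the top degree, so all of `𝒜 m` would consist of multiples of
  -- `a`, which are too few.
  · have hz : Module.finrank k (𝒜 (β + m)) = 0 := by rw [htop _ (by omega), finrank_bot]
    have := Submodule.finrank_le (LinearMap.range (mulPiece hb (rfl : β + m = β + m)))
    have hlt : (if α ≤ m then ((m - α + (t + 2)).choose (t + 2) : ℤ) else 0) <
        (m + (t + 2)).choose (t + 2) := by
      split_ifs
      · exact_mod_cast choose_lt_choose_left (t := t + 1) (by omega) (by omega)
      · exact_mod_cast Nat.choose_pos (by omega)
    omega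

/-- The partner `b` need not be homogeneous, so it is replaced by a homogeneous element generating
the same ideal. Both degrees are positive because nonzero elements of degree zero are scalars, hence
units. -/
theorem not_isExactPair [∀ i, FiniteDimensional k (𝒜 i)] {m t α : ℕ} {a b : A}
    (hnd : Nondegenerate 𝒜 (2 * m)) (h1 : Module.finrank k (𝒜 (2 * m)) = 1)
    (htop : ∀ d, 2 * m < d → 𝒜 d = ⊥) (h0 : ∀ x ∈ 𝒜 0, ∃ r : k, algebraMap k A r = x)
    (hdim : ∀ i ≤ m, Module.finrank k (𝒜 i) = (i + (t + 2)).choose (t + 2))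
    (hdom : ∀ i j, i + j ≤ m → ∀ x ∈ 𝒜 i, ∀ y ∈ 𝒜 j, x * y = 0 → x = 0 ∨ y = 0)
    (ha : a ∈ 𝒜 α) : ¬ IsExactPair a b := by
  rintro ⟨ha0, hb0, hann_a, hann_b⟩
  have hA : ∀ x, a * x = 0 ↔ b ∣ x := fun x => by
    rw [← Ideal.mem_span_singleton, ← hann_a, Submodule.mem_colon_singleton]
    simp [mul_comm]
  have hB : ∀ x, b * x = 0 ↔ a ∣ x := fun x => by
    rw [← Ideal.mem_span_singleton, ← hann_b, Submodule.mem_colon_singleton]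
    simp [mul_comm]
  obtain ⟨β, b', hb', hbb', hb'b⟩ := exists_homogeneous_associated h0 htop ha hb0 hA
  have hab' : a * b' = 0 := (hA _).2 hbb'
  have hb'0 : b' ≠ 0 := by
    rintro rfl
    exact hb0 (zero_dvd_iff.1 hb'b)
  have hpos : ∀ {i} {x y : A}, x ∈ 𝒜 i → x ≠ 0 → y ≠ 0 → x * y = 0 → 1 ≤ i := by
    intro i x y hx hx0 hy hxy
    by_contra hi
    obtain rfl : i = 0 := by omega
    obtain ⟨r, rfl⟩ := h0 _ hx
    have hr : r ≠ 0 := by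
      rintro rfl
      simp at hx0
    exact hy (((IsUnit.mk0 r hr).map (algebraMap k A)).mul_right_eq_zero.1 hxy)
  refine not_forall_dvd_of_mul_eq_zero hnd h1 htop hdim hdom (hpos ha ha0 hb'0 hab')
    (hpos hb' hb'0 ha0 (by rwa [mul_comm])) ha ha0 hb' hab' fun x hx => (hB x).1 ?_
  obtain ⟨z, rfl⟩ := hb'b
  rw [mul_right_comm, hx, zero_mul]

end ExactPairs

/-! ### Dimensions of the homogeneous pieces of `P`. -/

section PolynomialPieces

variable {k : Type*} [Field k] {c : ℕ}

theorem polyPiece_natCast (d : ℕ) : polyPiece k c d = homogeneousSubmodule (Fin c) k d := by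
  simp [polyPiece]

theorem polyPiece_of_neg {d : ℤ} (hd : d < 0) : polyPiece k c d = ⊥ := by
  simp [polyPiece, hd]

theorem finrank_homogeneousSubmodule (t d : ℕ) :
    Module.finrank k (homogeneousSubmodule (Fin (t + 1)) k d) = (d + t).choose t := by
  classical
  have hs : homogeneousSubmodule (Fin (t + 1)) k d = restrictSupport k
      (Finset.finsuppAntidiag (Finset.univ : Finset (Fin (t + 1))) d : Set (Fin (t + 1) →₀ ℕ)) := by
    rw [homogeneousSubmodule_eq_finsupp_supported, restrictSupport]
    congr 1
    ext x
    simp [Finsupp.degree_eq_sum]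
  rw [hs, Module.finrank_eq_nat_card_basis (basisRestrictSupport k _), Nat.card_coe_set_eq,
    Set.ncard_coe_finset, Finset.card_finsuppAntidiag_nat_eq_choose, Finset.card_univ,
    Fintype.card_fin, show t + 1 + d - 1 = d + t by omega, Nat.choose_symm_add]

instance (d : ℕ) : FiniteDimensional k (homogeneousSubmodule (Fin c) k d) :=
  Module.Finite.iff_fg.2 (homogeneousSubmodule_fg _ _ _)

instance (d : ℤ) : FiniteDimensional k (polyPiece k c d) := by
  by_cases hd : 0 ≤ d
  · rw [polyPiece, if_pos hd]
    infer_instance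
  · rw [polyPiece, if_neg hd]
    infer_instance

end PolynomialPieces

attribute [local instance] MvPolynomial.gradedAlgebra

/-! ### The grading of `P/I`. -/

section QuotientGrading

variable {k : Type*} [Field k] {c : ℕ} {I : Ideal (MvPolynomial (Fin c) k)}

instance (d : ℤ) : FiniteDimensional k (quotPiece I d) := by
  unfold quotPiece
  infer_instance

theorem mem_quotPiece_natCast {d : ℕ} {x : MvPolynomial (Fin c) k ⧸ I} :
    x ∈ quotPiece I d ↔
      ∃ p : MvPolynomial (Fin c) k, p.IsHomogeneous d ∧ Ideal.Quotient.mk I p = x := by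
  rw [quotPiece, polyPiece_natCast]
  rfl

theorem quotPiece_of_neg {d : ℤ} (hd : d < 0) : quotPiece I d = ⊥ := by
  simp [quotPiece, polyPiece_of_neg hd]

theorem GeneratedInDegreeGeTwo.isHomogeneous (hI : GeneratedInDegreeGeTwo I) :
    I.IsHomogeneous (homogeneousSubmodule (Fin c) k) := by
  obtain ⟨G, hG, rfl⟩ := hI
  refine Ideal.homogeneous_span _ _ fun g hg => ?_
  obtain ⟨d, -, hd⟩ := hG g hg
  exact ⟨d, hd⟩

/-- The natural-number indexed pieces of `P/I`. -/
noncomputable abbrev quotGrading (I : Ideal (MvPolynomial (Fin c) k)) (d : ℕ) :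
    Submodule k (MvPolynomial (Fin c) k ⧸ I) := quotPiece I d

/-- The residue class map between homogeneous components. -/
noncomputable def mkPiece (I : Ideal (MvPolynomial (Fin c) k)) (d : ℕ) :
    homogeneousSubmodule (Fin c) k d →ₗ[k] quotGrading I d :=
  (Ideal.Quotient.mkₐ k I).toLinearMap.restrict fun p hp => mem_quotPiece_natCast.2 ⟨p, hp, rfl⟩

/-- The components of the residue class of a polynomial. -/
noncomputable def componentsMk (I : Ideal (MvPolynomial (Fin c) k)) :
    MvPolynomial (Fin c) k →+ ⨁ d, quotGrading I d :=
  (DirectSum.lmap (mkPiece I)).toAddMonoidHom.comp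
    (DirectSum.decomposeAddEquiv (homogeneousSubmodule (Fin c) k)).toAddMonoidHom

theorem coe_componentsMk_apply (p : MvPolynomial (Fin c) k) (d : ℕ) :
    (componentsMk I p d : MvPolynomial (Fin c) k ⧸ I) =
      Ideal.Quotient.mk I (decompose (homogeneousSubmodule (Fin c) k) p d) := rfl

theorem componentsMk_coe {d : ℕ} (p : homogeneousSubmodule (Fin c) k d) :
    componentsMk I (p : MvPolynomial (Fin c) k) =
      DirectSum.of (fun d => quotGrading I d) d (mkPiece I d p) := by
  change DirectSum.lmap (mkPiece I) (decompose (homogeneousSubmodule (Fin c) k) _) = _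
  rw [DirectSum.decompose_coe, DirectSum.lmap_of]

theorem coe_mkPiece {d : ℕ} (p : homogeneousSubmodule (Fin c) k d) :
    (mkPiece I d p : MvPolynomial (Fin c) k ⧸ I) = Ideal.Quotient.mk I p := rfl

/-- This is where homogeneity of `I` enters: it lets the decomposition of `P/I` be computed from an
arbitrary representative. -/
theorem componentsMk_congr (hI : I.IsHomogeneous (homogeneousSubmodule (Fin c) k))
    {p q : MvPolynomial (Fin c) k} (h : Ideal.Quotient.mk I p = Ideal.Quotient.mk I q) :
    componentsMk I p = componentsMk I q := by
  have h0 : componentsMk I (p - q) = 0 := by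
    ext d
    rw [coe_componentsMk_apply, DirectSum.zero_apply, Submodule.coe_zero,
      Ideal.Quotient.eq_zero_iff_mem]
    exact hI d (Ideal.Quotient.eq.1 h)
  rw [← sub_add_cancel p q, map_add, h0, zero_add]

theorem coeAddMonoidHom_componentsMk (p : MvPolynomial (Fin c) k) :
    DirectSum.coeAddMonoidHom (quotGrading I) (componentsMk I p) = Ideal.Quotient.mk I p := by
  induction p using DirectSum.Decomposition.inductionOn (homogeneousSubmodule (Fin c) k) with
  | zero => simp
  | homogeneous m => rw [componentsMk_coe, DirectSum.coeAddMonoidHom_of, coe_mkPiece]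
  | add p q hp hq => rw [map_add, map_add, map_add, hp, hq]

/-- The grading of `P/I` for a homogeneous ideal `I`. -/
noncomputable abbrev quotGradedAlgebra (hI : I.IsHomogeneous (homogeneousSubmodule (Fin c) k)) :
    GradedAlgebra (quotGrading I) where
  one_mem := mem_quotPiece_natCast.2 ⟨1, isHomogeneous_one _ _, rfl⟩
  mul_mem i j x y hx hy := by
    obtain ⟨p, hp, rfl⟩ := mem_quotPiece_natCast.1 hx
    obtain ⟨q, hq, rfl⟩ := mem_quotPiece_natCast.1 hy
    exact mem_quotPiece_natCast.2 ⟨p * q, hp.mul hq, map_mul _ _ _⟩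
  decompose' x := componentsMk I (Quotient.out x)
  left_inv x := (coeAddMonoidHom_componentsMk _).trans (Ideal.Quotient.mk_out x)
  right_inv x := by
    have hout : ∀ p : MvPolynomial (Fin c) k,
        componentsMk I (Quotient.out (Ideal.Quotient.mk I p)) = componentsMk I p :=
      fun p => componentsMk_congr hI (Ideal.Quotient.mk_out _)
    have hsurj : ∃ p, componentsMk I p = x := by
      induction x using DirectSum.induction_on with
      | zero => exact ⟨0, map_zero _⟩
      | of d y =>
        obtain ⟨p, hp, hpy⟩ := mem_quotPiece_natCast.1 y.2
        refine ⟨p, (componentsMk_coe ⟨p, hp⟩).trans ?_⟩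
        congr 1
        exact Subtype.ext hpy
      | add x y hx hy =>
        obtain ⟨p, rfl⟩ := hx
        obtain ⟨q, rfl⟩ := hy
        exact ⟨p + q, map_add _ _ _⟩
    obtain ⟨p, rfl⟩ := hsurj
    rw [coeAddMonoidHom_componentsMk]
    exact hout p

end QuotientGrading

/-! ### Socle and top degree of `P/I`. -/

section SocleOfQuotient

variable {k : Type*} [Field k] {c : ℕ} {I : Ideal (MvPolynomial (Fin c) k)}

theorem mem_socle_of_forall_mul_eq_zero {x : MvPolynomial (Fin c) k ⧸ I}
    (h : ∀ j, 1 ≤ j → ∀ y ∈ quotGrading I j, x * y = 0) : x ∈ socle I := by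
  have hle : quotPlus I ≤ LinearMap.ker (LinearMap.mulLeft (MvPolynomial (Fin c) k ⧸ I) x) := by
    rw [quotPlus, polyPlus, Ideal.map_span, Ideal.span_le]
    rintro _ ⟨_, ⟨i, rfl⟩, rfl⟩
    exact h 1 le_rfl _ (mem_quotPiece_natCast.2 ⟨X i, isHomogeneous_X _ _, rfl⟩)
  refine Submodule.mem_colon.2 fun y hy => ?_
  simpa using hle hy

theorem IsGorenstein.ne_top (hG : IsGorenstein I) : I ≠ ⊤ := by
  rintro rfl
  have : Subsingleton (MvPolynomial (Fin c) k ⧸ (⊤ : Ideal (MvPolynomial (Fin c) k))) :=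
    Ideal.Quotient.subsingleton_iff.2 rfl
  have h0 : algType (⊤ : Ideal (MvPolynomial (Fin c) k)) = 0 := Module.finrank_zero_of_subsingleton
  rw [IsGorenstein, h0] at hG
  exact zero_ne_one hG

theorem exists_algebraMap_eq_of_mem_quotGrading_zero {x : MvPolynomial (Fin c) k ⧸ I}
    (hx : x ∈ quotGrading I 0) : ∃ r : k, algebraMap k _ r = x := by
  obtain ⟨p, hp, rfl⟩ := mem_quotPiece_natCast.1 hx
  have := totalDegree_eq_zero_iff_eq_C.1 (Nat.le_zero.1 hp.totalDegree_le)
  exact ⟨coeff 0 p, by rw [this]; simp; rfl⟩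

/-- An Artinian quotient is finite-dimensional over `k`, so only finitely many of its independent
pieces are nonzero; the piece of degree zero contains `1`. -/
theorem exists_top_degree [IsArtinianRing (MvPolynomial (Fin c) k ⧸ I)]
    (hI : I.IsHomogeneous (homogeneousSubmodule (Fin c) k)) (htop : I ≠ ⊤) :
    ∃ e : ℕ, quotGrading I e ≠ ⊥ ∧ ∀ d, e < d → quotGrading I d = ⊥ := by
  classical
  let := quotGradedAlgebra hI
  have : Module.Finite k (MvPolynomial (Fin c) k ⧸ I) := Module.finite_of_isArtinianRing k _
  have hfin : {d | quotGrading I d ≠ ⊥}.Finite := WellFoundedGT.finite_ne_bot_of_iSupIndep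
    (DirectSum.Decomposition.isInternal (quotGrading I)).submodule_iSupIndep
  have hne : {d | quotGrading I d ≠ ⊥}.Nonempty := by
    refine ⟨0, fun h => ?_⟩
    have h1 : (1 : MvPolynomial (Fin c) k ⧸ I) ∈ quotGrading I 0 := SetLike.GradedOne.one_mem
    rw [h, Submodule.mem_bot] at h1
    have := Ideal.Quotient.nontrivial_iff.2 htop
    exact one_ne_zero h1
  refine ⟨hfin.toFinset.max' (by simpa using hne), ?_, fun d hd => ?_⟩
  · simpa using hfin.toFinset.max'_mem (by simpa using hne)
  · by_contra h
    exact hd.not_ge (hfin.toFinset.le_max' d (by simpa using h))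

variable {e : ℕ}

/-- The top piece is killed by positive degrees, so it is a nonzero subspace of a one-dimensional
socle. -/
theorem IsGorenstein.socle_eq (hG : IsGorenstein I)
    (hI : I.IsHomogeneous (homogeneousSubmodule (Fin c) k)) (he : quotGrading I e ≠ ⊥)
    (htop : ∀ d, e < d → quotGrading I d = ⊥) : quotGrading I e = socle I := by
  let := quotGradedAlgebra hI
  have : FiniteDimensional k (socle I) :=
    FiniteDimensional.of_finrank_pos (by rw [show Module.finrank k (socle I) = 1 from hG]; omega)
  refine Submodule.eq_of_le_of_finrank_le (fun x hx => mem_socle_of_forall_mul_eq_zero ?_) ?_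
  · intro j hj y hy
    have : x * y ∈ quotGrading I (e + j) := SetLike.GradedMul.mul_mem hx hy
    rwa [htop _ (by omega), Submodule.mem_bot] at this
  · rw [show Module.finrank k (socle I) = 1 from hG, Nat.one_le_iff_ne_zero]
    exact fun h => he (Submodule.finrank_eq_zero.1 h)

theorem IsGorenstein.isLevel (hG : IsGorenstein I)
    (hI : I.IsHomogeneous (homogeneousSubmodule (Fin c) k)) (he : quotGrading I e ≠ ⊥)
    (htop : ∀ d, e < d → quotGrading I d = ⊥) : IsLevel I e := by
  have := hG.socle_eq hI he htop
  exact ⟨this ▸ he, this.ge⟩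

theorem IsGorenstein.finrank_quotGrading (hG : IsGorenstein I)
    (hI : I.IsHomogeneous (homogeneousSubmodule (Fin c) k)) (he : quotGrading I e ≠ ⊥)
    (htop : ∀ d, e < d → quotGrading I d = ⊥) : Module.finrank k (quotGrading I e) = 1 := by
  rw [hG.socle_eq hI he htop]
  exact hG

theorem IsGorenstein.nondegenerate (hG : IsGorenstein I)
    (hI : I.IsHomogeneous (homogeneousSubmodule (Fin c) k)) (he : quotGrading I e ≠ ⊥)
    (htop : ∀ d, e < d → quotGrading I d = ⊥) : Nondegenerate (quotGrading I) e := by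
  let := quotGradedAlgebra hI
  refine nondegenerate_of_socle_le _ htop (fun x hx => ?_)
    fun i j x hi hj h0 => eq_of_mem_of_mem hi hj h0
  rw [hG.socle_eq hI he htop]
  exact mem_socle_of_forall_mul_eq_zero hx

end SocleOfQuotient

/-! ### Graded strands of the resolution and its shifts. -/

section Strands

variable {k : Type*} [Field k] {c : ℕ}

theorem one_notMem_polyPlus : (1 : MvPolynomial (Fin c) k) ∉ polyPlus k c := by
  intro h
  have hle : polyPlus k c ≤ RingHom.ker (constantCoeff (R := k) (σ := Fin c)) := by
    rw [polyPlus, Ideal.span_le]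
    rintro _ ⟨i, rfl⟩
    simp
  simpa using hle h

theorem mem_polyPlus_of_isHomogeneous {d : ℕ} (hd : 1 ≤ d) {p : MvPolynomial (Fin c) k}
    (hp : p.IsHomogeneous d) : p ∈ polyPlus k c := by
  rw [polyPlus, ← Set.image_univ, mem_ideal_span_X_image]
  intro m hm
  by_contra! h
  have hm0 : m = 0 := Finsupp.ext fun i => by simpa using h i
  have := hp (mem_support_iff.1 hm)
  rw [hm0, map_zero] at this
  omega

/-- The homogeneous component of a polynomial of integral degree. -/
noncomputable def polyComponent (d : ℤ) : MvPolynomial (Fin c) k →ₗ[k] MvPolynomial (Fin c) k :=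
  if 0 ≤ d then homogeneousComponent d.toNat else 0

theorem polyComponent_natCast (d : ℕ) (p : MvPolynomial (Fin c) k) :
    polyComponent d p = homogeneousComponent d p := by
  simp [polyComponent]

theorem polyComponent_of_neg {d : ℤ} (hd : d < 0) (p : MvPolynomial (Fin c) k) :
    polyComponent d p = 0 := by
  simp [polyComponent, hd.not_ge]

theorem polyComponent_mem (d : ℤ) (p : MvPolynomial (Fin c) k) :
    polyComponent d p ∈ polyPiece k c d := by
  rcases lt_or_ge d 0 with hd | hd
  · simp [polyComponent_of_neg hd]
  · lift d to ℕ using hd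
    rw [polyComponent_natCast, polyPiece_natCast]
    exact homogeneousComponent_mem _ _

theorem polyComponent_of_mem {d : ℤ} {p : MvPolynomial (Fin c) k} (hp : p ∈ polyPiece k c d) :
    polyComponent d p = p := by
  rcases lt_or_ge d 0 with hd | hd
  · rw [polyPiece_of_neg hd, Submodule.mem_bot] at hp
    simp [hp]
  · lift d to ℕ using hd
    rw [polyPiece_natCast] at hp
    rw [polyComponent_natCast]
    exact homogeneousComponent_eq_self hp

theorem polyComponent_mul {s t : ℤ} (p : MvPolynomial (Fin c) k) {q : MvPolynomial (Fin c) k}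
    (hq : q ∈ polyPiece k c t) : polyComponent (s + t) (p * q) = polyComponent s p * q := by
  have hdec : ∀ (p : MvPolynomial (Fin c) k) (i : ℕ),
      homogeneousComponent i p = decompose (homogeneousSubmodule (Fin c) k) p i :=
    fun p i => (decomposition.decompose'_apply p i).symm
  rcases lt_or_ge t 0 with ht | ht
  · rw [polyPiece_of_neg ht, Submodule.mem_bot] at hq
    simp [hq]
  lift t to ℕ using ht
  rw [polyPiece_natCast] at hq
  rcases lt_or_ge (s + t) 0 with hst | hst
  · rw [polyComponent_of_neg hst, polyComponent_of_neg (by omega), zero_mul]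
  rcases lt_or_ge s 0 with hs | hs
  · rw [polyComponent_of_neg hs, zero_mul]
    obtain ⟨u, hu⟩ := Int.eq_ofNat_of_zero_le hst
    rw [hu, polyComponent_natCast, hdec]
    exact coe_decompose_mul_of_right_mem_of_not_le _ hq (by omega)
  · lift s to ℕ using hs
    rw [← Nat.cast_add, polyComponent_natCast, polyComponent_natCast, hdec, hdec]
    exact coe_decompose_mul_add_of_right_mem _ hq

/-- The component of degree `d` of a graded free module, as a vector space. -/
noncomputable def strand {r : ℕ} (a : Fin r → ℤ) (d : ℤ) :
    Submodule k (Fin r → MvPolynomial (Fin c) k) :=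
  Submodule.pi Set.univ fun j => polyPiece k c (d - a j)

theorem mem_strand {r : ℕ} {a : Fin r → ℤ} {d : ℤ} {x : Fin r → MvPolynomial (Fin c) k} :
    x ∈ strand a d ↔ x ∈ freePiece a d := by
  simp [strand, freePiece]

/-- A strand is the product of its coordinate pieces. -/
noncomputable def strandEquiv {r : ℕ} (a : Fin r → ℤ) (d : ℤ) :
    (strand a d : Submodule k (Fin r → MvPolynomial (Fin c) k)) ≃ₗ[k]
      ((j : Fin r) → polyPiece k c (d - a j)) where
  toFun x j := ⟨x.1 j, mem_strand.1 x.2 j⟩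
  invFun y := ⟨fun j => y j, mem_strand.2 fun j => (y j).2⟩
  map_add' _ _ := rfl
  map_smul' _ _ := rfl

instance {r : ℕ} (a : Fin r → ℤ) (d : ℤ) :
    FiniteDimensional k (strand a d : Submodule k (Fin r → MvPolynomial (Fin c) k)) :=
  Module.Finite.equiv (strandEquiv a d).symm

theorem finrank_strand {r : ℕ} (a : Fin r → ℤ) (d : ℤ) :
    Module.finrank k (strand a d : Submodule k (Fin r → MvPolynomial (Fin c) k)) =
      ∑ j, Module.finrank k (polyPiece k c (d - a j)) := by
  rw [(strandEquiv a d).finrank_eq, Module.finrank_pi_fintype]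

/-- The homogeneous component of an element of a graded free module. -/
noncomputable def freeComponent {r : ℕ} (a : Fin r → ℤ) (d : ℤ)
    (x : Fin r → MvPolynomial (Fin c) k) : Fin r → MvPolynomial (Fin c) k :=
  fun j => polyComponent (d - a j) (x j)

theorem freeComponent_mem {r : ℕ} (a : Fin r → ℤ) (d : ℤ) (x : Fin r → MvPolynomial (Fin c) k) :
    freeComponent a d x ∈ strand a d :=
  mem_strand.2 fun _ => polyComponent_mem _ _

theorem freeComponent_of_mem {r : ℕ} {a : Fin r → ℤ} {d : ℤ} {x : Fin r → MvPolynomial (Fin c) k}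
    (hx : x ∈ strand a d) : freeComponent a d x = x :=
  funext fun j => polyComponent_of_mem (mem_strand.1 hx j)

theorem single_mem_freePiece {r : ℕ} (a : Fin r → ℤ) (v : Fin r) :
    (Pi.single v 1 : Fin r → MvPolynomial (Fin c) k) ∈ freePiece a (a v) := by
  intro j
  rcases eq_or_ne j v with rfl | h
  · rw [Pi.single_eq_same, sub_self]
    exact (polyPiece_natCast (k := k) (c := c) 0).symm ▸ isHomogeneous_one _ _
  · rw [Pi.single_eq_of_ne h]
    exact zero_mem _

theorem map_eq_sum_single {R N : Type*} [CommRing R] [AddCommGroup N] [Module R N] {r : ℕ}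
    (g : (Fin r → R) →ₗ[R] N) (x : Fin r → R) : g x = ∑ v, x v • g (Pi.single v 1) := by
  conv_lhs => rw [pi_eq_sum_univ' x, map_sum]
  simp [map_smul]

theorem apply_mem_of_mem_smul_top {R : Type*} [CommRing R] {r : ℕ} {J : Ideal R} {x : Fin r → R}
    (hx : x ∈ J • (⊤ : Submodule R (Fin r → R))) (v : Fin r) : x v ∈ J := by
  have : J • (⊤ : Submodule R (Fin r → R)) ≤
      Submodule.comap (LinearMap.proj v : (Fin r → R) →ₗ[R] R) J :=
    Submodule.smul_le.2 fun a ha y _ => by simpa using J.mul_mem_right _ ha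
  exact this hx

theorem finrank_eq_finrank_map_add {K V W : Type*} [Field K] [AddCommGroup V] [Module K V]
    [AddCommGroup W] [Module K W] (g : V →ₗ[K] W) (U : Submodule K V) [FiniteDimensional K U] :
    Module.finrank K U =
      Module.finrank K (U.map g) + Module.finrank K (U ⊓ LinearMap.ker g : Submodule K V) := by
  rw [← (g.domRestrict U).finrank_range_add_finrank_ker, LinearMap.range_domRestrict,
    LinearMap.ker_domRestrict, ← Submodule.map_comap_subtype, Submodule.finrank_map_subtype_eq]

namespace MinimalResolution

variable {I : Ideal (MvPolynomial (Fin c) k)} (F : MinimalResolution I)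

theorem f_single_apply_mem (i : ℕ) (v : Fin (F.rank (i + 1))) (u : Fin (F.rank i)) :
    F.f i (Pi.single v 1) u ∈ polyPiece k c (F.deg (i + 1) v - F.deg i u) :=
  F.f_homogeneous i _ _ (single_mem_freePiece _ v) u

/-- The matrix entries are homogeneous of the degree prescribed by the shifts, so differentials
commute with taking components. This turns exactness into exactness in each degree. -/
theorem f_freeComponent (i : ℕ) (d : ℤ) (x : Fin (F.rank (i + 1)) → MvPolynomial (Fin c) k) :
    F.f i (freeComponent (F.deg (i + 1)) d x) = freeComponent (F.deg i) d (F.f i x) := by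
  funext u
  rw [freeComponent, map_eq_sum_single (F.f i), map_eq_sum_single (F.f i) x]
  simp only [Finset.sum_apply, Pi.smul_apply, smul_eq_mul, map_sum]
  refine Finset.sum_congr rfl fun v _ => ?_
  rw [show d - F.deg i u = (d - F.deg (i + 1) v) + (F.deg (i + 1) v - F.deg i u) by ring,
    polyComponent_mul _ (F.f_single_apply_mem i v u), freeComponent]

theorem aug_freeComponent (hI : I.IsHomogeneous (homogeneousSubmodule (Fin c) k)) {d : ℤ}
    {x : Fin (F.rank 0) → MvPolynomial (Fin c) k} (hx : F.aug x ∈ quotPiece I d) :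
    F.aug (freeComponent (F.deg 0) d x) = F.aug x := by
  obtain ⟨w, hw, hwx⟩ := hx
  have hm : ∀ v, ∃ m ∈ polyPiece k c (F.deg 0 v), Ideal.Quotient.mk I m = F.aug (Pi.single v 1) :=
    fun v => F.aug_homogeneous _ _ (single_mem_freePiece _ v)
  choose m hm hmF using hm
  have haug : ∀ y, F.aug y = Ideal.Quotient.mk I (∑ v, y v * m v) := by
    intro y
    rw [map_eq_sum_single F.aug, map_sum]
    refine Finset.sum_congr rfl fun v _ => ?_
    rw [← hmF, map_mul]
    rfl
  -- Both polynomials lift `F.aug x`; since `I` is homogeneous, their components of degree `d` also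
  -- agree modulo `I`.
  have hsub : w - ∑ v, x v * m v ∈ I := by
    rw [← Ideal.Quotient.eq, ← haug, ← hwx]
    rfl
  have hcomp : polyComponent d (w - ∑ v, x v * m v) ∈ I := by
    rcases lt_or_ge d 0 with hd | hd
    · rw [polyComponent_of_neg hd]
      exact zero_mem _
    · lift d to ℕ using hd
      rw [polyComponent_natCast]
      exact homogeneousComponent_mem_of_mem hI hsub d
  rw [map_sub, polyComponent_of_mem hw, map_sum, ← Ideal.Quotient.eq] at hcomp
  rw [← hwx, haug]
  refine (Eq.trans hcomp ?_).symm
  congr 1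
  refine Finset.sum_congr rfl fun v _ => ?_
  rw [freeComponent, ← polyComponent_mul _ (hm v), sub_add_cancel]

/-- The image of `f_{i+1}` in degree `d`. -/
noncomputable def boundaries (i : ℕ) (d : ℤ) :
    Submodule k (Fin (F.rank i) → MvPolynomial (Fin c) k) :=
  (strand (F.deg (i + 1)) d).map ((F.f i).restrictScalars k)

theorem strand_inf_ker_f (i : ℕ) (d : ℤ) :
    strand (F.deg (i + 1)) d ⊓ LinearMap.ker ((F.f i).restrictScalars k) =
      F.boundaries (i + 1) d := by
  ext x
  constructor
  · rintro ⟨hx, hfx⟩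
    obtain ⟨y, rfl⟩ := (F.exact_succ i x).1 hfx
    refine ⟨_, freeComponent_mem _ d y, ?_⟩
    exact (F.f_freeComponent _ d y).trans (freeComponent_of_mem hx)
  · rintro ⟨y, hy, rfl⟩
    exact ⟨mem_strand.2 (F.f_homogeneous _ _ _ (mem_strand.1 hy)), (F.exact_succ i _).2 ⟨y, rfl⟩⟩

theorem strand_inf_ker_aug (d : ℤ) :
    strand (F.deg 0) d ⊓ LinearMap.ker (F.aug.restrictScalars k) = F.boundaries 0 d := by
  ext x
  constructor
  · rintro ⟨hx, hfx⟩
    obtain ⟨y, rfl⟩ := (F.exact_zero x).1 hfx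
    refine ⟨_, freeComponent_mem _ d y, ?_⟩
    exact (F.f_freeComponent _ d y).trans (freeComponent_of_mem hx)
  · rintro ⟨y, hy, rfl⟩
    exact ⟨mem_strand.2 (F.f_homogeneous _ _ _ (mem_strand.1 hy)), (F.exact_zero _).2 ⟨y, rfl⟩⟩

theorem map_aug_strand (hI : I.IsHomogeneous (homogeneousSubmodule (Fin c) k)) (d : ℤ) :
    (strand (F.deg 0) d).map (F.aug.restrictScalars k) = quotPiece I d := by
  ext z
  constructor
  · rintro ⟨y, hy, rfl⟩
    exact F.aug_homogeneous _ _ (mem_strand.1 hy)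
  · intro hz
    obtain ⟨y, rfl⟩ := F.aug_surjective z
    exact ⟨_, freeComponent_mem _ d y, F.aug_freeComponent hI hz⟩

theorem finrank_strand_zero (hI : I.IsHomogeneous (homogeneousSubmodule (Fin c) k)) (d : ℤ) :
    Module.finrank k (strand (F.deg 0) d : Submodule k (Fin _ → MvPolynomial (Fin c) k)) =
      hilbert I d + Module.finrank k (F.boundaries 0 d) := by
  rw [finrank_eq_finrank_map_add (F.aug.restrictScalars k), F.strand_inf_ker_aug,
    F.map_aug_strand hI, hilbert]

theorem finrank_strand_succ (i : ℕ) (d : ℤ) :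
    Module.finrank k (strand (F.deg (i + 1)) d : Submodule k (Fin _ → MvPolynomial (Fin c) k)) =
      Module.finrank k (F.boundaries i d) + Module.finrank k (F.boundaries (i + 1) d) := by
  rw [finrank_eq_finrank_map_add ((F.f i).restrictScalars k), F.strand_inf_ker_f]
  rfl

theorem single_notMem_range (i : ℕ) (v : Fin (F.rank i)) :
    (Pi.single v 1 : Fin (F.rank i) → MvPolynomial (Fin c) k) ∉ LinearMap.range (F.f i) := by
  intro h
  have := apply_mem_of_mem_smul_top (F.minimal i h) v
  rw [Pi.single_eq_same] at this
  exact one_notMem_polyPlus this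

/-- The structure does not fix `F_0 = P`, so this is drawn from minimality. A generator of negative
degree would map to zero and hence be a boundary. -/
theorem deg_zero (v : Fin (F.rank 0)) : F.deg 0 v = 0 := by
  have hmem := F.aug_homogeneous _ _ (single_mem_freePiece (F.deg 0) v)
  have hne : F.aug (Pi.single v 1) ≠ 0 := fun h =>
    F.single_notMem_range 0 v ((F.exact_zero _).1 h)
  rcases lt_trichotomy (F.deg 0 v) 0 with h | h | h
  · rw [quotPiece_of_neg h] at hmem
    exact absurd (by simpa using hmem) hne
  · exact h
  · obtain ⟨d, hd⟩ := Int.eq_ofNat_of_zero_le h.le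
    rw [hd] at hmem
    obtain ⟨p, hp, hpv⟩ := mem_quotPiece_natCast.1 hmem
    have hp' := mem_polyPlus_of_isHomogeneous (by omega) hp
    obtain ⟨y, hy⟩ := F.aug_surjective 1
    -- A generator of positive degree maps to the class of some `p ∈ P_+`, as does `p • y` with `y`
    -- over `1`. The difference is a boundary, so minimality would put `1` in `P_+`.
    have hker : F.aug (Pi.single v 1 - p • y) = 0 := by
      rw [map_sub, map_smul, hy, ← hpv, sub_eq_zero]
      exact (mul_one (Ideal.Quotient.mk I p)).symm
    have hmin := F.minimal 0 ((F.exact_zero _).1 hker)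
    have h1 := apply_mem_of_mem_smul_top hmin v
    rw [Pi.sub_apply, Pi.single_eq_same, Pi.smul_apply, smul_eq_mul] at h1
    have := Ideal.add_mem _ h1 (Ideal.mul_mem_right (y v) _ hp')
    rw [sub_add_cancel] at this
    exact absurd this one_notMem_polyPlus

/-- No column of the matrix is zero, since a basis vector in the kernel would be a boundary. A
nonzero entry has only one degree: both `n` and the difference of shifts. -/
theorem exists_deg_eq_add {i n : ℕ} (h : F.EntriesOfDegree i n) (v : Fin (F.rank (i + 1))) :
    ∃ u, F.deg (i + 1) v = F.deg i u + n := by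
  have hne : F.f i (Pi.single v 1) ≠ 0 := fun h =>
    F.single_notMem_range (i + 1) v ((F.exact_succ i _).1 h)
  obtain ⟨u, hu⟩ := Function.ne_iff.1 hne
  refine ⟨u, ?_⟩
  have hmem := F.f_single_apply_mem i v u
  rcases lt_or_ge (F.deg (i + 1) v - F.deg i u) 0 with hd | hd
  · rw [polyPiece_of_neg hd] at hmem
    exact absurd (by simpa using hmem) hu
  · obtain ⟨d, hd⟩ := Int.eq_ofNat_of_zero_le hd
    rw [hd, polyPiece_natCast] at hmem
    have := IsHomogeneous.inj_right hmem (h u v) hu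
    omega

end MinimalResolution

end Strands

/-! ### The Hilbert series and the socle degree. -/

section HilbertSeries

/-- Comparing degrees in `(1 - X) ^ (s + 2) * H = Q + b * X ^ (2 * n + s)` for a polynomial `H`. -/
theorem add_two_eq_of_one_sub_pow_mul {s n e : ℕ} {h : ℕ → ℤ} (he : h e ≠ 0)
    (htop : ∀ d, e < d → h d = 0) (hn : 1 ≤ n) (hne : n ≤ e + 1) {Q : Polynomial ℤ}
    (hQ : Q.natDegree ≤ n + s) {b : ℤ}
    (heq : (1 - PowerSeries.X) ^ (s + 2) * PowerSeries.mk h =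
      (Q : PowerSeries ℤ) + PowerSeries.C b * PowerSeries.X ^ (2 * n + s)) : e + 2 = 2 * n := by
  let H : Polynomial ℤ := PowerSeries.trunc (e + 1) (PowerSeries.mk h)
  have hcoeff : ∀ d, H.coeff d = h d := fun d => by
    simp only [H, PowerSeries.coeff_trunc, PowerSeries.coeff_mk]
    split_ifs with hd
    · rfl
    · exact (htop d (by omega)).symm
  have hH : (H : PowerSeries ℤ) = PowerSeries.mk h := by
    ext d
    simp [hcoeff]
  have hHdeg : H.natDegree = e := by
    refine Polynomial.natDegree_eq_of_le_of_coeff_ne_zero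
      (Polynomial.natDegree_le_iff_coeff_eq_zero.2 fun d hd => ?_) (by rwa [hcoeff])
    rw [hcoeff, htop d hd]
  have hH0 : H ≠ 0 := fun h0 => he (by rw [← hcoeff, h0, Polynomial.coeff_zero])
  -- The sign is moved onto `H` so that the other factor is monic and degrees add.
  have hpoly : (Polynomial.X - Polynomial.C 1) ^ (s + 2) * ((-1) ^ (s + 2) * H) =
      Q + Polynomial.C b * Polynomial.X ^ (2 * n + s) := by
    apply Polynomial.coe_injective
    rw [← mul_assoc, ← mul_pow]
    push_cast
    rw [hH, ← heq, map_one, mul_neg_one, neg_sub]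
  have hdeg : (Q + Polynomial.C b * Polynomial.X ^ (2 * n + s)).natDegree = s + 2 + e := by
    rw [← hpoly, Polynomial.Monic.natDegree_mul' ((Polynomial.monic_X_sub_C 1).pow _)
        (mul_ne_zero (pow_ne_zero _ (by norm_num)) hH0),
      (Polynomial.monic_X_sub_C (1 : ℤ)).natDegree_pow, Polynomial.natDegree_X_sub_C, mul_one]
    congr 1
    rcases neg_one_pow_eq_or (Polynomial ℤ) (s + 2) with h1 | h1 <;> simp [h1, hHdeg]
  -- Without the last term the degree `s + 2 + e` would be at most `n + s`, against `n ≤ e + 1`.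
  by_cases hb : b = 0
  · rw [hb, map_zero, zero_mul, add_zero] at hdeg
    omega
  · rw [Polynomial.natDegree_add_eq_right_of_natDegree_lt, Polynomial.natDegree_C_mul_X_pow _ _ hb]
      at hdeg
    · omega
    · rw [Polynomial.natDegree_C_mul_X_pow _ _ hb]
      omega

variable {k : Type*} [Field k]

theorem finrank_polyPiece_natCast (t d : ℕ) :
    Module.finrank k (polyPiece k (t + 1) d) = (d + t).choose t := by
  rw [polyPiece_natCast, finrank_homogeneousSubmodule]

theorem one_sub_pow_mul_mk_finrank_strand {t r a : ℕ} {g : Fin r → ℤ} (hg : ∀ v, g v = a) :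
    (1 - PowerSeries.X) ^ (t + 1) * PowerSeries.mk (fun d : ℕ => (Module.finrank k
      (strand g d : Submodule k (Fin r → MvPolynomial (Fin (t + 1)) k)) : ℤ)) =
    PowerSeries.C (r : ℤ) * PowerSeries.X ^ a := by
  have hmk : PowerSeries.mk (fun d : ℕ => (Module.finrank k
      (strand g d : Submodule k (Fin r → MvPolynomial (Fin (t + 1)) k)) : ℤ)) =
      PowerSeries.C (r : ℤ) * (PowerSeries.X ^ a * (PowerSeries.invOneSubPow ℤ (t + 1)).val) := by
    ext d
    rw [PowerSeries.coeff_mk, PowerSeries.coeff_C_mul, PowerSeries.coeff_X_pow_mul',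
      finrank_strand, Finset.sum_congr rfl fun v _ => by rw [hg v], Finset.sum_const,
      Finset.card_univ, Fintype.card_fin, smul_eq_mul, Nat.cast_mul]
    congr 1
    split_ifs with h
    · rw [← Nat.cast_sub h, finrank_polyPiece_natCast,
        PowerSeries.invOneSubPow_val_succ_eq_mk_add_choose, PowerSeries.coeff_mk, add_comm]
    · rw [polyPiece_of_neg (by omega), finrank_bot, Nat.cast_zero]
  have hinv : (1 - PowerSeries.X) ^ (t + 1) * (PowerSeries.invOneSubPow ℤ (t + 1)).val = 1 := by
    rw [← PowerSeries.invOneSubPow_inv_eq_one_sub_pow]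
    exact (PowerSeries.invOneSubPow ℤ (t + 1)).inv_val
  rw [hmk, mul_left_comm, mul_left_comm ((1 - PowerSeries.X) ^ (t + 1)), hinv, mul_one]

namespace MinimalResolution

section LowDegree

variable {t n : ℕ} {I : Ideal (MvPolynomial (Fin (t + 1)) k)} (F : MinimalResolution I)
  (hI : I.IsHomogeneous (homogeneousSubmodule (Fin (t + 1)) k)) (hn : 1 ≤ n)
  (hfirst : F.EntriesOfDegree 0 n)
include hI hfirst

/-- All generators of `F_1` have degree `n`, so below degree `n` nothing of `F_0` is divided out. -/
theorem hilbert_eq_rank_zero_mul {i : ℕ} (hi : i < n) :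
    hilbert I i = F.rank 0 * (i + t).choose t := by
  have hbot : strand (F.deg 1) (i : ℤ) =
      (⊥ : Submodule k (Fin (F.rank 1) → MvPolynomial (Fin (t + 1)) k)) := by
    rw [eq_bot_iff]
    intro x hx
    refine (Submodule.mem_bot k).2 (funext fun v => ?_)
    obtain ⟨u, hu⟩ := F.exists_deg_eq_add hfirst v
    have := mem_strand.1 hx v
    rw [polyPiece_of_neg (by rw [hu.trans (by rw [F.deg_zero])]; omega)] at this
    exact this
  have hz : F.boundaries 0 i = ⊥ :=
    (congrArg (Submodule.map _) hbot).trans (Submodule.map_bot _)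
  have := F.finrank_strand_zero hI i
  rw [hz, finrank_bot, add_zero, finrank_strand,
    Finset.sum_congr rfl fun v _ => by rw [F.deg_zero v, sub_zero, finrank_polyPiece_natCast]]
    at this
  rw [← this]
  simp

include hn in
theorem hilbert_eq_choose (htop : I ≠ ⊤) {i : ℕ} (hi : i < n) :
    hilbert I i = (i + t).choose t := by
  have h0 := F.hilbert_eq_rank_zero_mul hI hfirst (show 0 < n by omega)
  have hle : hilbert I (0 : ℕ) ≤ 1 := by
    refine (Submodule.finrank_map_le _ _).trans ?_
    rw [finrank_polyPiece_natCast]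
    simp
  -- In degree zero the Hilbert function equals the rank of `F_0` and is at most one, so excluding
  -- zero gives rank one.
  have hne : F.rank 0 ≠ 0 := by
    intro h
    have := Ideal.Quotient.nontrivial_iff.2 htop
    have : IsEmpty (Fin (F.rank 0)) := by
      rw [h]
      infer_instance
    obtain ⟨y, hy⟩ := F.aug_surjective 1
    rw [Subsingleton.elim y 0, map_zero] at hy
    exact zero_ne_one hy
  rw [F.hilbert_eq_rank_zero_mul hI hfirst hi]
  simp only [zero_add, Nat.choose_self, mul_one] at h0
  rw [show F.rank 0 = 1 by omega, one_mul]

end LowDegree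

variable {s n : ℕ} {I : Ideal (MvPolynomial (Fin (s + 2)) k)} (F : MinimalResolution I)
  (hfirst : F.EntriesOfDegree 0 n)
  (hmid : ∀ i, 1 ≤ i → i + 1 < s + 2 → F.EntriesOfDegree i 1)
  (hlast : F.EntriesOfDegree (s + 1) n)
include hfirst hmid

theorem deg_succ {i : ℕ} (hi : i ≤ s) (v : Fin (F.rank (i + 1))) :
    F.deg (i + 1) v = (n + i : ℕ) := by
  induction i with
  | zero =>
    obtain ⟨u, hu⟩ := F.exists_deg_eq_add hfirst v
    rw [hu, F.deg_zero]
    simp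
  | succ i ih =>
    obtain ⟨u, hu⟩ := F.exists_deg_eq_add (hmid (i + 1) (by omega) (by omega)) v
    rw [hu, ih (by omega) u]
    push_cast
    ring

include hlast

theorem deg_last (v : Fin (F.rank (s + 2))) : F.deg (s + 2) v = (2 * n + s : ℕ) := by
  obtain ⟨u, hu⟩ := F.exists_deg_eq_add hlast v
  rw [hu, F.deg_succ hfirst hmid le_rfl u]
  push_cast
  ring

/-- Descending induction along the resolution, starting from the injective last map. The shifts `n +
i ≤ n + s` are absorbed into `Q`, while `b` is, up to sign, the rank of `F_c`. -/
theorem exists_one_sub_pow_mul_boundaries {j i : ℕ} (hj : i + j = s + 1) :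
    ∃ Q : Polynomial ℤ, Q.natDegree ≤ n + s ∧ ∃ b : ℤ,
      (1 - PowerSeries.X) ^ (s + 2) *
        PowerSeries.mk (fun d : ℕ => (Module.finrank k (F.boundaries i d) : ℤ)) =
      (Q : PowerSeries ℤ) + PowerSeries.C b * PowerSeries.X ^ (2 * n + s) := by
  induction j generalizing i with
  | zero =>
    obtain rfl : i = s + 1 := by omega
    refine ⟨0, by simp, F.rank (s + 2), ?_⟩
    rw [Polynomial.coe_zero, zero_add, ← one_sub_pow_mul_mk_finrank_strand
      (k := k) (F.deg_last hfirst hmid hlast)]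
    congr 2
    funext d
    have hz : F.boundaries (s + 2) d = ⊥ := by
      have hr := F.rank_eq_zero (s + 3) (by omega)
      have : IsEmpty (Fin (F.rank (s + 3))) := by
        rw [hr]
        infer_instance
      rw [boundaries, Subsingleton.elim (strand (F.deg (s + 2 + 1)) (d : ℤ)) ⊥, Submodule.map_bot]
    rw [F.finrank_strand_succ, hz, finrank_bot, add_zero]
  | succ j ih =>
    obtain ⟨Q, hQ, b, hb⟩ := ih (i := i + 1) (by omega)
    refine ⟨Polynomial.C (F.rank (i + 1) : ℤ) * Polynomial.X ^ (n + i) - Q, ?_, -b, ?_⟩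
    · refine (Polynomial.natDegree_sub_le_of_le (Polynomial.natDegree_C_mul_X_pow_le _ _)
        hQ).trans ?_
      simp
      omega
    · have hadd : PowerSeries.mk (fun d : ℕ => (Module.finrank k (F.boundaries i d) : ℤ)) =
          PowerSeries.mk (fun d : ℕ => (Module.finrank k (strand (F.deg (i + 1)) d :
            Submodule k (Fin _ → MvPolynomial (Fin (s + 2)) k)) : ℤ)) -
          PowerSeries.mk (fun d : ℕ => (Module.finrank k (F.boundaries (i + 1) d) : ℤ)) := by
        ext d
        simp [F.finrank_strand_succ]
      rw [hadd, mul_sub, hb, one_sub_pow_mul_mk_finrank_strand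
        (k := k) (F.deg_succ hfirst hmid (by omega))]
      push_cast
      rw [map_neg]
      ring

theorem exists_one_sub_pow_mul_hilbert
    (hI : I.IsHomogeneous (homogeneousSubmodule (Fin (s + 2)) k)) :
    ∃ Q : Polynomial ℤ, Q.natDegree ≤ n + s ∧ ∃ b : ℤ,
      (1 - PowerSeries.X) ^ (s + 2) * PowerSeries.mk (fun d : ℕ => (hilbert I d : ℤ)) =
      (Q : PowerSeries ℤ) + PowerSeries.C b * PowerSeries.X ^ (2 * n + s) := by
  obtain ⟨Q, hQ, b, hb⟩ := F.exists_one_sub_pow_mul_boundaries hfirst hmid hlast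
    (show 0 + (s + 1) = s + 1 by omega)
  refine ⟨Polynomial.C (F.rank 0 : ℤ) - Q, ?_, -b, ?_⟩
  · exact (Polynomial.natDegree_sub_le _ _).trans (by simpa using hQ)
  · have hadd : PowerSeries.mk (fun d : ℕ => (hilbert I d : ℤ)) =
        PowerSeries.mk (fun d : ℕ => (Module.finrank k (strand (F.deg 0) d :
          Submodule k (Fin _ → MvPolynomial (Fin (s + 2)) k)) : ℤ)) -
        PowerSeries.mk (fun d : ℕ => (Module.finrank k (F.boundaries 0 d) : ℤ)) := by
      ext d
      simp [F.finrank_strand_zero hI]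
    rw [hadd, mul_sub, hb, one_sub_pow_mul_mk_finrank_strand (k := k) (a := 0)
      (fun v => by simp [F.deg_zero])]
    push_cast
    rw [map_neg]
    ring

/-- The socle degree of a Gorenstein algebra with linear resolution. -/
theorem top_degree_add_two {e : ℕ} (hn : 1 ≤ n)
    (hI : I.IsHomogeneous (homogeneousSubmodule (Fin (s + 2)) k)) (htop : I ≠ ⊤)
    (he : quotGrading I e ≠ ⊥) (hbot : ∀ d, e < d → quotGrading I d = ⊥) : e + 2 = 2 * n := by
  obtain ⟨Q, hQ, b, hb⟩ := F.exists_one_sub_pow_mul_hilbert hfirst hmid hlast hI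
  refine add_two_eq_of_one_sub_pow_mul (h := fun d => (hilbert I d : ℤ)) ?_ ?_ hn ?_ hQ hb
  · exact_mod_cast fun h => he (Submodule.finrank_eq_zero.1 h)
  · intro d hd
    rw [hilbert, show quotPiece I (d : ℤ) = ⊥ from hbot d hd, finrank_bot, Nat.cast_zero]
  -- If `e + 1 < n`, then `S` would agree with `P` in degree `e + 1`, where `S` vanishes and `P`
  -- does not.
  · by_contra! h
    have h1 := F.hilbert_eq_choose hI hn hfirst htop (show e + 1 < n by omega)
    rw [hilbert, show quotPiece I ((e + 1 : ℕ) : ℤ) = ⊥ from hbot _ (by omega), finrank_bot] at h1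
    exact (Nat.choose_pos (by omega)).ne h1

end MinimalResolution

end HilbertSeries

/-! ### Compressedness and absence of exact zero divisors. -/

section Compressed

variable {k : Type*} [Field k]

theorem finrank_quotGrading_le {c : ℕ} (I : Ideal (MvPolynomial (Fin c) k)) (d : ℕ) :
    Module.finrank k (quotGrading I d) ≤ Module.finrank k (polyPiece k c d) :=
  Submodule.finrank_map_le _ _

/-- In at most one variable every Gorenstein algebra is compressed. -/
theorem IsGorenstein.isCompressedLevel_of_le_one {c : ℕ} {I : Ideal (MvPolynomial (Fin c) k)}
    (hc : c ≤ 1) (hG : IsGorenstein I) (hI : I.IsHomogeneous (homogeneousSubmodule (Fin c) k))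
    {e : ℕ} (he : quotGrading I e ≠ ⊥) (htop : ∀ d, e < d → quotGrading I d = ⊥) :
    IsCompressedLevel I := by
  let := quotGradedAlgebra hI
  have hnd := hG.nondegenerate hI he htop
  have h1 := hG.finrank_quotGrading hI he htop
  refine ⟨e, hG.isLevel hI he htop, fun i hi hie => ?_⟩
  have hle : ∀ d : ℕ, Module.finrank k (polyPiece k c d) ≤ 1 := by
    intro d
    obtain rfl | rfl : c = 0 ∨ c = 1 := by omega
    · refine (Submodule.finrank_le _).trans ?_
      exact ((isEmptyAlgEquiv k (Fin 0)).toLinearEquiv.finrank_eq.trans (Module.finrank_self k)).le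
    · rw [finrank_polyPiece_natCast (t := 0)]
      simp
  -- Since `[P]_e = [P]_i [P]_j`, a vanishing piece of degree `i ≤ e` would kill the top piece. So
  -- every dimension in the claimed formula is one.
  have hpos : ∀ i j : ℕ, i + j = e → 1 ≤ Module.finrank k (quotGrading I i) := by
    rintro i j rfl
    rw [Nat.one_le_iff_ne_zero]
    intro h
    rw [Submodule.finrank_eq_zero] at h
    refine he (eq_bot_iff.2 fun x hx => ?_)
    obtain ⟨p, hp, rfl⟩ := mem_quotPiece_natCast.1 hx
    have hle : homogeneousSubmodule (Fin c) k i * homogeneousSubmodule (Fin c) k j ≤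
        I.restrictScalars k := Submodule.mul_le.2 fun q hq r _ => by
      have : Ideal.Quotient.mk I q ∈ quotGrading I i := mem_quotPiece_natCast.2 ⟨q, hq, rfl⟩
      rw [h, Submodule.mem_bot, Ideal.Quotient.eq_zero_iff_mem] at this
      exact I.mul_mem_right r this
    rw [← homogeneousSubmodule_one_pow k i, ← homogeneousSubmodule_one_pow k j,
      ← pow_add, homogeneousSubmodule_one_pow] at hle
    exact (Submodule.mem_bot k).2 (Ideal.Quotient.eq_zero_iff_mem.2 (hle hp))
  lift i to ℕ using hi
  obtain ⟨j, rfl⟩ := Nat.exists_eq_add_of_le (show i ≤ e by exact_mod_cast hie)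
  have hi1 := hpos i j rfl
  have hj1 := hpos j i (add_comm _ _)
  have := finrank_quotGrading_le I i
  have := finrank_quotGrading_le I j
  have := hle i
  have := hle j
  rw [show algType I = 1 from hG, show ((i + j : ℕ) : ℤ) - i = j by push_cast; ring,
    hilbert, one_mul]
  change Module.finrank k (quotGrading I i) = _
  omega

/-- A Gorenstein algebra of socle degree `2 * m` that agrees with the polynomial ring up to
degree `m` is compressed. -/
theorem IsGorenstein.isCompressedLevel {t m : ℕ} {I : Ideal (MvPolynomial (Fin (t + 1)) k)}
    (hG : IsGorenstein I) (hI : I.IsHomogeneous (homogeneousSubmodule (Fin (t + 1)) k))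
    (he : quotGrading I (2 * m) ≠ ⊥) (htop : ∀ d, 2 * m < d → quotGrading I d = ⊥)
    (hdim : ∀ i ≤ m, Module.finrank k (quotGrading I i) = (i + t).choose t) :
    IsCompressedLevel I := by
  let := quotGradedAlgebra hI
  have hnd := hG.nondegenerate hI he htop
  have h1 := hG.finrank_quotGrading hI he htop
  refine ⟨(2 * m : ℕ), hG.isLevel hI he htop, fun i hi hie => ?_⟩
  lift i to ℕ using hi
  obtain ⟨j, hj⟩ := Nat.exists_eq_add_of_le (show i ≤ 2 * m by exact_mod_cast hie)
  have hsym := finrank_eq_of_nondegenerate hj.symm hnd h1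
  rw [show algType I = 1 from hG, one_mul, show ((2 * m : ℕ) : ℤ) - i = j by omega,
    finrank_polyPiece_natCast, finrank_polyPiece_natCast, hilbert]
  rcases le_total i m with him | him
  · rw [hdim i him, min_eq_left (Nat.choose_le_choose _ (by omega))]
  · rw [hsym, hdim j (by omega), min_eq_right (Nat.choose_le_choose _ (by omega))]

/-- If the Hilbert functions of `P` and `P/I` agree in degree `d`, then `I` has no nonzero form of
degree `d`. -/
theorem eq_zero_of_mk_eq_zero {c d : ℕ} {I : Ideal (MvPolynomial (Fin c) k)}
    (hdim : Module.finrank k (quotGrading I d) = Module.finrank k (polyPiece k c d))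
    {p : MvPolynomial (Fin c) k} (hp : p.IsHomogeneous d) (h : Ideal.Quotient.mk I p = 0) :
    p = 0 := by
  have h1 := finrank_eq_finrank_map_add (Ideal.Quotient.mkₐ k I).toLinearMap (polyPiece k c d)
  change _ = Module.finrank k (quotGrading I d) + _ at h1
  have h2 := Submodule.finrank_eq_zero.1 (show Module.finrank k (polyPiece k c d ⊓
    LinearMap.ker (Ideal.Quotient.mkₐ k I).toLinearMap : Submodule k _) = 0 by omega)
  have : p ∈ polyPiece k c d ⊓ LinearMap.ker (Ideal.Quotient.mkₐ k I).toLinearMap :=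
    ⟨(polyPiece_natCast (k := k) (c := c) d).symm ▸ hp, h⟩
  rw [h2] at this
  exact this

/-- Up to degree `m` the ideal contains no nonzero form, so products can be computed in the domain
`P`. -/
theorem eq_zero_or_eq_zero_of_mul_eq_zero {c m : ℕ} {I : Ideal (MvPolynomial (Fin c) k)}
    (hdim : ∀ i ≤ m, Module.finrank k (quotGrading I i) = Module.finrank k (polyPiece k c i))
    {i j : ℕ} (hij : i + j ≤ m) {x y : MvPolynomial (Fin c) k ⧸ I} (hx : x ∈ quotGrading I i)
    (hy : y ∈ quotGrading I j) (hxy : x * y = 0) : x = 0 ∨ y = 0 := by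
  obtain ⟨p, hp, rfl⟩ := mem_quotPiece_natCast.1 hx
  obtain ⟨q, hq, rfl⟩ := mem_quotPiece_natCast.1 hy
  have := eq_zero_of_mk_eq_zero (hdim _ hij) (hp.mul hq) (by rwa [map_mul])
  rcases mul_eq_zero.1 this with rfl | rfl
  · exact Or.inl (map_zero _)
  · exact Or.inr (map_zero _)

theorem IsGorenstein.not_isHomogeneousExactZeroDivisor {t m : ℕ}
    {I : Ideal (MvPolynomial (Fin (t + 2 + 1)) k)}
    (hG : IsGorenstein I) (hI : I.IsHomogeneous (homogeneousSubmodule (Fin (t + 2 + 1)) k))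
    (he : quotGrading I (2 * m) ≠ ⊥) (htop : ∀ d, 2 * m < d → quotGrading I d = ⊥)
    (hdim : ∀ i ≤ m, Module.finrank k (quotGrading I i) = (i + (t + 2)).choose (t + 2))
    (a : MvPolynomial (Fin (t + 2 + 1)) k ⧸ I) : ¬ IsHomogeneousExactZeroDivisor I a := by
  let := quotGradedAlgebra hI
  rintro ⟨⟨d, hd⟩, b, hab⟩
  rcases lt_or_ge d 0 with hneg | hpos
  · rw [quotPiece_of_neg hneg] at hd
    exact hab.1 (by simpa using hd)
  · lift d to ℕ using hpos
    refine not_isExactPair (𝒜 := quotGrading I) (hG.nondegenerate hI he htop)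
      (hG.finrank_quotGrading hI he htop) htop
      (fun x hx => exists_algebraMap_eq_of_mem_quotGrading_zero hx) hdim ?_ hd hab
    intro i j hij x hx y hy hxy
    refine eq_zero_or_eq_zero_of_mul_eq_zero (fun i hi => ?_) hij hx hy hxy
    rw [hdim i hi, finrank_polyPiece_natCast]

end Compressed

end GradedArtin

open MvPolynomial in
theorem mainTheorem6 {k : Type*} [Field k] (c : ℕ) (I : Ideal (MvPolynomial (Fin c) k))
    (hI : GradedArtin.GeneratedInDegreeGeTwo I)
    (hS : IsArtinianRing (MvPolynomial (Fin c) k ⧸ I))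
    (hG : GradedArtin.IsGorenstein I)
    (F : GradedArtin.MinimalResolution I) (hF : F.IsLinear) :
    GradedArtin.IsCompressedLevel I ∧
      ∀ e : ℤ, GradedArtin.IsLevel I e →
        GradedArtin.ConditionA c e (GradedArtin.algType I) →
          ¬ ∃ a : MvPolynomial (Fin c) k ⧸ I,
            GradedArtin.IsHomogeneousExactZeroDivisor I a := by
  have hIh := hI.isHomogeneous
  obtain ⟨e, he, htop⟩ := GradedArtin.exists_top_degree hIh hG.ne_top
  -- For `c ≥ 2` the maps `f_1` and `f_c` are distinct and the shifts can be read off as above.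
  rcases Nat.lt_or_ge c 2 with hc | hc
  · exact ⟨hG.isCompressedLevel_of_le_one (by omega) hIh he htop,
      fun e' _ hA => absurd hA.2.2.2 (by omega)⟩
  obtain ⟨s, rfl⟩ : ∃ s, c = s + 2 := ⟨c - 2, by omega⟩
  obtain ⟨n, hn, hfirst, -, hlin⟩ := hF
  obtain ⟨hlast, hmid⟩ := hlin hG
  have hen := F.top_degree_add_two hfirst hmid (hlast (s + 1) rfl) (by omega) hIh hG.ne_top he htop
  obtain ⟨m, rfl⟩ : ∃ m, n = m + 1 := ⟨n - 1, by omega⟩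
  obtain rfl : e = 2 * m := by omega
  have hdim : ∀ i ≤ m, Module.finrank k (GradedArtin.quotGrading I i) =
      (i + (s + 1)).choose (s + 1) :=
    fun i hi => F.hilbert_eq_choose hIh (by omega) hfirst hG.ne_top (by omega)
  refine ⟨hG.isCompressedLevel hIh he htop hdim, fun e' _ hA => ?_⟩
  -- Here `c ≥ 3` is used, through `c = t + 3`: in two variables `D` is eventually constant.
  obtain ⟨t, rfl⟩ : ∃ t, s = t + 1 := ⟨s - 1, by have := hA.2.2.2; omega⟩
  rintro ⟨a, ha⟩
  exact hG.not_isHomogeneousExactZeroDivisor hIh he htop hdim a ha
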